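/- Let $\mathbb{N}=\{1,2,3,\dots\}$ and let $\mathcal{S}_1=\{F\subset\mathbb{N}\text{ finite, nonempty}: \mathrm{card}\,F\leqslant\min F\}\cup\{\emptyset\}$ be the Schreier family. Let $c_{00}$ be the space of finitely supported real sequences indexed by $\mathbb{N}$, with standard unit vectors $(e_i)_{i\in\mathbb{N}}$. Schreier's space $X_{\mathcal{S}_1}$ is the completion of $c_{00}$ in the norm $$\|x\|=\sup_{F\in\mathcal{S}_1}\sum_{k\in F}|a_k|,\qquad x=(a_k)_{k\in\mathbb{N}}\in c_{00},$$ regarded as a space of sequences through the continuous extensions of the coordinate functionals $(a_k)\mapsto a_n$. Theorem (Isometries of Schreier's space). A linear map $T:X_{\mathcal{S}_1}\to X_{\mathcal{S}_1}$ is a surjective isometry if and only if there is a sequence of signs $(\varepsilon_n)\in\{-1,1\}^{\mathbb{N}}$ such that $T(a_n)_n=(\varepsilon_n a_n)_n$ for every $(a_n)_n\in X_{\mathcal{S}_1}$. Moreover, there is a group isomorphism from $\{-1,1\}^{\mathbb{N}}\cong\mathbb{Z}_2^{\mathbb{N}}$ (with the pointwise product) onto the group of surjective linear isometries of $X_{\mathcal{S}_1}$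 that sends each $(\varepsilon_n)$ to an isometry $T$ with $Te_i=\varepsilon_i e_i$ for all $i\in\mathbb{N}$. -/

import Mathlib

noncomputable section

/-- The Schreier family `S₁` on the positive integers: the finite sets `F` with
`card F ≤ min F`, together with the empty set. -/
def schreierFamily : Set (Finset ℕ+) :=
  {F | ∃ h : F.Nonempty, F.card ≤ (F.min' h : ℕ)} ∪ {∅}

/-- The space `c₀₀` of finitely supported real sequences indexed by the positive integers
(a type synonym, which carries the Schreier norm below). -/
def C00 : Type := ℕ+ →₀ ℝ

namespace C00

instance : AddCommGroup C00 := inferInstanceAs (AddCommGroup (ℕ+ →₀ ℝ))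
instance : Module ℝ C00 := inferInstanceAs (Module ℝ (ℕ+ →₀ ℝ))
instance : FunLike C00 ℕ+ ℝ := inferInstanceAs (FunLike (ℕ+ →₀ ℝ) ℕ+ ℝ)

theorem add_apply (x y : C00) (n : ℕ+) : (x + y) n = x n + y n := Finsupp.add_apply x y n
theorem smul_apply (c : ℝ) (x : C00) (n : ℕ+) : (c • x) n = c * x n := rfl
theorem zero_apply (n : ℕ+) : (0 : C00) n = 0 := rfl
theorem ext {x y : C00} (h : ∀ n, x n = y n) : x = y := Finsupp.ext h

/-- The standard unit vectors of `c₀₀`. -/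
def unitVec (i : ℕ+) : C00 := Finsupp.single i (1 : ℝ)

/-- The Schreier norm `‖x‖ = sup_{F ∈ S₁} ∑_{k ∈ F} |x k|` on `c₀₀`. -/
instance : Norm C00 := ⟨fun x => ⨆ F : schreierFamily, ∑ k ∈ F.1, |x k|⟩

theorem norm_def (x : C00) : ‖x‖ = ⨆ F : schreierFamily, ∑ k ∈ F.1, |x k| := rfl

instance : Nonempty schreierFamily := ⟨⟨∅, Or.inr rfl⟩⟩

theorem bddAbove (x : C00) :
    BddAbove (Set.range fun F : schreierFamily => ∑ k ∈ F.1, |x k|) := by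
  classical
  let s : Finset ℕ+ := Finsupp.support (show ℕ+ →₀ ℝ from x)
  refine ⟨∑ k ∈ s, |x k|, ?_⟩
  rintro _ ⟨F, rfl⟩
  have h : ∑ k ∈ F.1, |x k| = ∑ k ∈ F.1 ∩ s, |x k| := by
    refine (Finset.sum_subset Finset.inter_subset_left fun k hk hk' => ?_).symm
    have : k ∉ s := fun h => hk' (Finset.mem_inter.2 ⟨hk, h⟩)
    have h0 : x k = 0 := Finsupp.notMem_support_iff.1 this
    simp [h0]
  exact h.le.trans
    (Finset.sum_le_sum_of_subset_of_nonneg Finset.inter_subset_right fun _ _ _ => abs_nonneg _)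

theorem sum_le_norm (x : C00) {F : Finset ℕ+} (hF : F ∈ schreierFamily) :
    ∑ k ∈ F, |x k| ≤ ‖x‖ :=
  le_ciSup (bddAbove x) (⟨F, hF⟩ : schreierFamily)

theorem singleton_mem (n : ℕ+) : ({n} : Finset ℕ+) ∈ schreierFamily :=
  Or.inl ⟨Finset.singleton_nonempty n, by simpa using Nat.succ_le_of_lt n.pos⟩

theorem abs_apply_le_norm (x : C00) (n : ℕ+) : |x n| ≤ ‖x‖ := by
  simpa using sum_le_norm x (singleton_mem n)

theorem normCore : NormedSpace.Core ℝ C00 where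
  norm_nonneg x := (abs_nonneg _).trans (abs_apply_le_norm x 1)
  norm_smul c x := by
    simp only [norm_def, smul_apply, abs_mul, ← Finset.mul_sum, Real.norm_eq_abs]
    exact (Real.mul_iSup_of_nonneg (abs_nonneg c) _).symm
  norm_triangle x y := by
    refine ciSup_le fun F => ?_
    calc ∑ k ∈ F.1, |(x + y) k| ≤ ∑ k ∈ F.1, (|x k| + |y k|) :=
          Finset.sum_le_sum fun k _ => by rw [add_apply]; exact abs_add_le _ _
      _ = ∑ k ∈ F.1, |x k| + ∑ k ∈ F.1, |y k| := Finset.sum_add_distrib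
      _ ≤ ‖x‖ + ‖y‖ := add_le_add (sum_le_norm x F.2) (sum_le_norm y F.2)
  norm_eq_zero_iff x := by
    constructor
    · intro h
      refine ext fun n => ?_
      have := abs_apply_le_norm x n
      rw [h] at this
      rw [zero_apply]
      exact abs_nonpos_iff.1 this
    · rintro rfl
      simp [norm_def, zero_apply]

instance : NormedAddCommGroup C00 := NormedAddCommGroup.ofCore normCore
instance : NormedSpace ℝ C00 := NormedSpace.ofCore normCore

/-- The `n`-th coordinate functional on `c₀₀`, which is continuous for the Schreier norm. -/
def coord (n : ℕ+) : C00 →L[ℝ] ℝ :=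
  LinearMap.mkContinuous
    { toFun := fun x => x n
      map_add' := fun x y => add_apply x y n
      map_smul' := fun c x => smul_apply c x n } 1
    fun x => by simpa using abs_apply_le_norm x n

end C00

/-- Schreier's space: the completion of `c₀₀` in the Schreier norm. -/
abbrev SchreierSpace : Type := UniformSpace.Completion C00

namespace SchreierSpace

/-- The standard unit vectors of Schreier's space. -/
def e (i : ℕ+) : SchreierSpace :=
  (C00.unitVec i : UniformSpace.Completion C00)

/-- The `n`-th coordinate functional on Schreier's space: the continuous extension of the
coordinate functional of `c₀₀`. -/
def coord (n : ℕ+) : SchreierSpace →L[ℝ] ℝ :=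
  (C00.coord n).extend (UniformSpace.Completion.toComplL : C00 →L[ℝ] SchreierSpace)

theorem coord_coe (n : ℕ+) (x : C00) : coord n (x : SchreierSpace) = x n :=
  ContinuousLinearMap.extend_eq (C00.coord n)
    (e := (UniformSpace.Completion.toComplL : C00 →L[ℝ] SchreierSpace))
    UniformSpace.Completion.denseRange_coe (UniformSpace.Completion.isUniformInducing_coe C00) x

/-- The coordinates separate points, so that Schreier's space is a space of sequences. -/
theorem ext_coord {x y : SchreierSpace} (h : ∀ n, coord n x = coord n y) : x = y := by
  suffices H : ∀ z : SchreierSpace, (∀ n, coord n z = 0) → z = 0 by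
    exact sub_eq_zero.1 (H _ fun n => by rw [map_sub, h n, sub_self])
  intro z hz
  rw [← norm_le_zero_iff]
  refine le_of_forall_pos_le_add fun ε hε => ?_
  obtain ⟨w, hw⟩ := UniformSpace.Completion.denseRange_coe.exists_dist_lt z (half_pos hε)
  rw [dist_eq_norm] at hw
  have key : ∀ (v : SchreierSpace) (F : Finset ℕ+), F ∈ schreierFamily →
      ∑ k ∈ F, |coord k v| ≤ ‖v‖ := by
    intro v F hF
    induction v using UniformSpace.Completion.induction_on with
    | hp => exact isClosed_le (by fun_prop) (by fun_prop)
    | ih a =>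
      simp only [coord_coe, UniformSpace.Completion.norm_coe]
      exact C00.sum_le_norm a hF
  have hw' : ‖(w : SchreierSpace)‖ ≤ ε / 2 := by
    rw [UniformSpace.Completion.norm_coe, C00.norm_def]
    refine ciSup_le fun F => ?_
    refine le_trans (le_of_eq ?_) ((key (z - w) F.1 F.2).trans hw.le)
    refine Finset.sum_congr rfl fun k _ => ?_
    rw [map_sub, hz, coord_coe, zero_sub, abs_neg]
  have := norm_add_le (z - w) (w : SchreierSpace)
  rw [sub_add_cancel] at this
  linarith

end SchreierSpace

end

/-!
Why the isometries are diagonal.  The norm of Schreier's space is the supremum of the functionals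
`∑ k ∈ G, ± coord k` with `G` in the Schreier family.  If `F` is a maximal Schreier set
(`card F = min F`), then `∑ k ∈ F, coord k` is the only norm-one functional attaining the norm of
`∑ k ∈ F, e k`; `abs_apply_e_sub_le` is a quantitative form of this.  Hence, for a surjective
isometry `U`, the functional `(∑ k ∈ F, coord k) ∘ U` is approximated on each `e j` by functionals
of the form `∑ k ∈ G, ± coord k`, which take values in `{-1, 0, 1}` there
(`sum_coord_map_e_mem`).  Letting all elements of `F` other than its minimum `k` run to infinity
kills their contribution, because coordinates tend to zero, so every matrix entry
`coord k (U (e j))` lies in `{-1, 0, 1}` (`coord_map_e_mem`).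

Since `‖U (e j)‖ = 1` and all pairs of indices `≥ 2` are Schreier sets, `U (e j)` has at most one
nonzero entry beyond the first.  The vector `e 1` is distinguished by `‖e 1 ± e j‖ = 1` for all
`j ≠ 1`, which forces `U (e 1) = ± e 1` and then `U (e j) = ± e (π j)` for all `j`
(`exists_map_e_eq`).  Comparing norms of `∑ k ∈ F, e k` and its image for a maximal `F` with
minimum `n` gives `n ≤ π n` (`le_of_map_e_eq`); the same bound for the inverse isometry makes `π`
the identity.  Conversely, coordinatewise sign changes extend from `c₀₀` to the completion.
-/

open Filter Topology

namespace SchreierSpace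

/-! ### Schreier sets -/

theorem mem_schreierFamily_iff {F : Finset ℕ+} :
    F ∈ schreierFamily ↔ ∀ k ∈ F, F.card ≤ (k : ℕ) := by
  constructor
  · rintro (⟨h, hF⟩ | hF) k hk
    · exact hF.trans (PNat.coe_le_coe _ _ |>.2 (F.min'_le k hk))
    · rw [Set.mem_singleton_iff.1 hF] at hk
      simp at hk
  · intro h
    rcases F.eq_empty_or_nonempty with rfl | hne
    · exact Or.inr rfl
    · exact Or.inl ⟨hne, h _ (F.min'_mem hne)⟩

theorem pair_mem_schreierFamily {p q : ℕ+} (hp : p ≠ 1) (hq : q ≠ 1) :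
    ({p, q} : Finset ℕ+) ∈ schreierFamily := by
  have two_le : ∀ r : ℕ+, r ≠ 1 → 2 ≤ (r : ℕ) := fun r hr => by
    have h1 : (r : ℕ) ≠ 1 := fun h => hr (PNat.coe_eq_one_iff.1 h)
    have := r.pos
    omega
  rw [mem_schreierFamily_iff]
  intro k hk
  refine Finset.card_le_two.trans ?_
  rcases Finset.mem_insert.1 hk with rfl | hk
  · exact two_le _ hp
  · rw [Finset.mem_singleton.1 hk]
    exact two_le _ hq

/-- The Schreier set with minimum `k` and `k` elements whose other elements are
`m + 1, …, m + (k - 1)`; these claims about it hold when `k ≤ m`. -/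
def spread (k m : ℕ+) : Finset ℕ+ :=
  insert k ((Finset.range (k - 1)).image fun i => m + i.succPNat)

theorem add_succPNat_injective (m : ℕ+) : Function.Injective fun i : ℕ => m + i.succPNat :=
  fun _ _ h => Nat.succPNat_injective (add_left_cancel h)

theorem notMem_image_of_le {k m : ℕ+} (h : k ≤ m) (s : Finset ℕ) :
    k ∉ s.image fun i => m + i.succPNat := by
  intro hk
  obtain ⟨i, -, hi⟩ := Finset.mem_image.1 hk
  exact absurd (h.trans_lt (PNat.lt_add_right m i.succPNat)) (by rw [hi]; exact lt_irrefl _)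

theorem card_spread {k m : ℕ+} (h : k ≤ m) : (spread k m).card = k := by
  rw [spread, Finset.card_insert_of_notMem (notMem_image_of_le h _),
    Finset.card_image_of_injective _ (add_succPNat_injective m), Finset.card_range]
  exact Nat.sub_add_cancel k.pos

theorem mem_spread (k m : ℕ+) : k ∈ spread k m := Finset.mem_insert_self _ _

theorem spread_mem_schreierFamily {k m : ℕ+} (h : k ≤ m) : spread k m ∈ schreierFamily := by
  rw [mem_schreierFamily_iff]
  intro l hl
  rw [card_spread h, PNat.coe_le_coe]
  rcases Finset.mem_insert.1 hl with rfl | hl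
  · exact le_rfl
  · obtain ⟨i, -, rfl⟩ := Finset.mem_image.1 hl
    exact h.trans (PNat.lt_add_right m i.succPNat).le

/-! ### The norm and the coordinates -/

theorem sum_abs_coord_le_norm (v : SchreierSpace) {F : Finset ℕ+} (hF : F ∈ schreierFamily) :
    ∑ k ∈ F, |coord k v| ≤ ‖v‖ := by
  induction v using UniformSpace.Completion.induction_on with
  | hp => exact isClosed_le (by fun_prop) (by fun_prop)
  | ih a =>
    simp only [coord_coe, UniformSpace.Completion.norm_coe]
    exact C00.sum_le_norm a hF

theorem abs_coord_le_norm (v : SchreierSpace) (n : ℕ+) : |coord n v| ≤ ‖v‖ := by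
  simpa using sum_abs_coord_le_norm v (C00.singleton_mem n)

theorem abs_coord_add_abs_coord_le_norm (v : SchreierSpace) {p q : ℕ+} (hp : p ≠ 1) (hq : q ≠ 1)
    (hpq : p ≠ q) : |coord p v| + |coord q v| ≤ ‖v‖ := by
  simpa [Finset.sum_pair hpq] using sum_abs_coord_le_norm v (pair_mem_schreierFamily hp hq)

theorem norm_le_of_forall_sum_le {v : SchreierSpace} {C : ℝ}
    (h : ∀ F ∈ schreierFamily, ∑ k ∈ F, |coord k v| ≤ C) : ‖v‖ ≤ C := by
  refine le_of_forall_pos_le_add fun ε hε => ?_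
  obtain ⟨w, hw⟩ := UniformSpace.Completion.denseRange_coe.exists_dist_lt v (half_pos hε)
  rw [dist_eq_norm] at hw
  have hw' : ‖(w : SchreierSpace)‖ ≤ C + ε / 2 := by
    rw [UniformSpace.Completion.norm_coe, C00.norm_def]
    refine ciSup_le fun F => ?_
    calc ∑ k ∈ F.1, |w k| ≤ ∑ k ∈ F.1, (|coord k v| + |coord k (v - w)|) := by
          refine Finset.sum_le_sum fun k _ => ?_
          have : w k = coord k v - coord k (v - w) := by rw [map_sub, coord_coe]; ring
          rw [this]
          exact abs_sub _ _
      _ = ∑ k ∈ F.1, |coord k v| + ∑ k ∈ F.1, |coord k (v - w)| := Finset.sum_add_distrib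
      _ ≤ C + ε / 2 := add_le_add (h F.1 F.2) ((sum_abs_coord_le_norm _ F.2).trans hw.le)
  have := norm_add_le (v - w) (w : SchreierSpace)
  rw [sub_add_cancel] at this
  linarith

theorem exists_lt_sum_abs_coord {v : SchreierSpace} {c : ℝ} (h : c < ‖v‖) :
    ∃ F ∈ schreierFamily, c < ∑ k ∈ F, |coord k v| := by
  by_contra! H
  exact absurd (norm_le_of_forall_sum_le H) (not_le.2 h)

theorem norm_eq_of_abs_coord_eq {v w : SchreierSpace} (h : ∀ n, |coord n v| = |coord n w|) :
    ‖v‖ = ‖w‖ := by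
  apply le_antisymm <;> refine norm_le_of_forall_sum_le fun F hF => ?_
  · simpa only [h] using sum_abs_coord_le_norm w hF
  · simpa only [h] using sum_abs_coord_le_norm v hF

theorem coord_e (n i : ℕ+) : coord n (e i) = if i = n then 1 else 0 := by
  rw [e, coord_coe]
  exact Finsupp.single_apply

theorem coord_e_self (n : ℕ+) : coord n (e n) = 1 := by simp [coord_e]

theorem coord_sum_e (F : Finset ℕ+) (n : ℕ+) :
    coord n (∑ k ∈ F, e k) = if n ∈ F then 1 else 0 := by
  simp [map_sum, coord_e]

theorem norm_e (i : ℕ+) : ‖e i‖ = 1 := by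
  apply le_antisymm
  · refine norm_le_of_forall_sum_le fun F _ => ?_
    simp only [coord_e, apply_ite abs, abs_one, abs_zero, Finset.sum_ite_eq]
    split_ifs <;> norm_num
  · simpa [coord_e_self] using abs_coord_le_norm (e i) i

theorem coe_eq_sum (w : C00) :
    ∃ s : Finset ℕ+, (w : SchreierSpace) = ∑ k ∈ s, w k • e k := by
  let s : Finset ℕ+ := Finsupp.support (show ℕ+ →₀ ℝ from w)
  refine ⟨s, ext_coord fun n => ?_⟩
  simp only [map_sum, map_smul, coord_e, coord_coe, smul_eq_mul, mul_ite, mul_one, mul_zero,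
    Finset.sum_ite_eq']
  split_ifs with h
  · rfl
  · exact Finsupp.notMem_support_iff.1 h

theorem exists_norm_sub_sum_lt (v : SchreierSpace) {θ : ℝ} (hθ : 0 < θ) :
    ∃ (s : Finset ℕ+) (c : ℕ+ → ℝ), ‖v - ∑ k ∈ s, c k • e k‖ < θ := by
  obtain ⟨w, hw⟩ := UniformSpace.Completion.denseRange_coe.exists_dist_lt v hθ
  obtain ⟨s, hs⟩ := coe_eq_sum w
  exact ⟨s, w, by rwa [dist_eq_norm, hs] at hw⟩

theorem clm_ext_e {A B : SchreierSpace →L[ℝ] SchreierSpace} (h : ∀ i, A (e i) = B (e i)) :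
    A = B := by
  ext v
  induction v using UniformSpace.Completion.induction_on with
  | hp => exact isClosed_eq A.continuous B.continuous
  | ih w =>
    obtain ⟨s, hs⟩ := coe_eq_sum w
    simp [hs, map_sum, h]

theorem tendsto_coord (v : SchreierSpace) :
    Tendsto (fun n => coord n v) cofinite (𝓝 0) := by
  rw [Metric.tendsto_nhds]
  intro θ hθ
  obtain ⟨s, c, hs⟩ := exists_norm_sub_sum_lt v hθ
  filter_upwards [s.finite_toSet.compl_mem_cofinite] with n hn
  have hn' : n ∉ s := hn
  have h0 : coord n (∑ k ∈ s, c k • e k) = 0 := by simp [map_sum, coord_e, hn']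
  have := abs_coord_le_norm (v - ∑ k ∈ s, c k • e k) n
  rw [map_sub, h0, sub_zero] at this
  simpa using this.trans_lt hs

/-! ### Maximal Schreier sets and norming functionals -/

/-- A Schreier set with a point `m` satisfying `card F = m` is maximal, and perturbing the sum of
its unit vectors off `F` by at most one does not increase the norm: a Schreier set other than `F`
misses some element of `F`. -/
theorem norm_sum_e_add_le {F : Finset ℕ+} {m : ℕ+} (hm : m ∈ F) (hcard : F.card = m) {j : ℕ+}
    {t : ℝ} (ht : |t| ≤ 1) (hj : j ∉ F) : ‖∑ k ∈ F, e k + t • e j‖ ≤ F.card := by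
  classical
  refine norm_le_of_forall_sum_le fun G hG => ?_
  simp only [map_add, map_smul, coord_sum_e, coord_e, smul_eq_mul]
  by_cases hFG : F ⊆ G
  · have hGF : F = G := Finset.eq_of_subset_of_card_le hFG
      (hcard ▸ mem_schreierFamily_iff.1 hG m (hFG hm))
    subst hGF
    refine le_of_eq ?_
    rw [Finset.card_eq_sum_ones, Nat.cast_sum]
    refine Finset.sum_congr rfl fun k hk => ?_
    have : j ≠ k := fun h => hj (h ▸ hk)
    simp [hk, this]
  · have hlt : (F ∩ G).card < F.card := by
      refine Finset.card_lt_card ⟨Finset.inter_subset_left, fun h => hFG fun k hk => ?_⟩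
      exact Finset.mem_of_mem_inter_right (h hk)
    have hlt' : ((F ∩ G).card : ℝ) + 1 ≤ F.card := by exact_mod_cast hlt
    calc ∑ k ∈ G, |(if k ∈ F then (1 : ℝ) else 0) + t * (if j = k then 1 else 0)|
        ≤ ∑ k ∈ G, ((if k ∈ F then (1 : ℝ) else 0) + (if j = k then |t| else 0)) := by
          refine Finset.sum_le_sum fun k _ => (abs_add_le _ _).trans (le_of_eq ?_)
          split_ifs <;> simp
      _ = (F ∩ G).card + (if j ∈ G then |t| else 0) := by
          rw [Finset.sum_add_distrib, Finset.sum_ite_eq, Finset.sum_boole,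
            Finset.filter_mem_eq_inter, Finset.inter_comm]
      _ ≤ (F ∩ G).card + 1 := by
          gcongr
          split_ifs
          · exact ht
          · exact zero_le_one
      _ ≤ F.card := hlt'

theorem norm_sum_e {F : Finset ℕ+} (hF : F ∈ schreierFamily) : ‖∑ k ∈ F, e k‖ = F.card := by
  apply le_antisymm
  · refine (norm_sum_le _ _).trans ?_
    simp [norm_e]
  · refine le_trans (le_of_eq ?_) (sum_abs_coord_le_norm _ hF)
    rw [Finset.card_eq_sum_ones, Nat.cast_sum]
    exact Finset.sum_congr rfl fun k hk => by rw [coord_sum_e, if_pos hk]; simp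

/-- Quantitative uniqueness of the norming functional: a contractive functional which nearly
attains the norm of `∑ k ∈ F, e k`, for a maximal Schreier set `F`, is close to
`∑ k ∈ F, coord k` on unit vectors. -/
theorem abs_apply_e_sub_le {F : Finset ℕ+} {m : ℕ+} (hm : m ∈ F) (hcard : F.card = m)
    {g : SchreierSpace →ₗ[ℝ] ℝ} (hg : ∀ v, |g v| ≤ ‖v‖) {η : ℝ}
    (hη : F.card - η ≤ g (∑ k ∈ F, e k)) (i : ℕ+) :
    |g (e i) - (if i ∈ F then 1 else 0)| ≤ η := by
  classical
  by_cases hi : i ∈ F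
  · have h1 : ∀ k, g (e k) ≤ 1 := fun k => (le_abs_self _).trans ((hg _).trans (norm_e k).le)
    have h2 : ∑ k ∈ F.erase i, g (e k) ≤ F.card - 1 := by
      refine (Finset.sum_le_sum fun k _ => h1 k).trans (le_of_eq ?_)
      rw [Finset.sum_const, Finset.card_erase_of_mem hi, nsmul_eq_mul, mul_one,
        Nat.cast_sub (Finset.card_pos.2 ⟨i, hi⟩), Nat.cast_one]
    rw [map_sum, ← Finset.add_sum_erase _ _ hi] at hη
    have := h1 i
    rw [if_pos hi, abs_le]
    constructor <;> linarith
  · have key : ∀ t : ℝ, |t| ≤ 1 → t * g (e i) ≤ η := fun t ht => by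
      have := (le_abs_self _).trans ((hg _).trans (norm_sum_e_add_le hm hcard ht hi))
      rw [map_add, map_smul, smul_eq_mul] at this
      linarith
    have hp := key 1 (by simp)
    have hn := key (-1) (by simp)
    rw [if_neg hi, abs_le]
    constructor <;> linarith

theorem isClosed_neg_one_zero_one : IsClosed ({-1, 0, 1} : Set ℝ) := (Set.toFinite _).isClosed

/-- For a maximal Schreier set `F`, a signed sum `φ` of coordinates over some `G` in the Schreier
family nearly norms `U.symm (∑ k ∈ F, e k)`, so `φ ∘ U.symm` is close to `∑ k ∈ F, coord k` by
`abs_apply_e_sub_le`; at `U (e j)` the former takes the value `φ (e j)`, which is `-1`, `0`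
or `1`. -/
theorem sum_coord_map_e_mem (U : SchreierSpace ≃ₗᵢ[ℝ] SchreierSpace) {F : Finset ℕ+}
    (hF : F ∈ schreierFamily) {m : ℕ+} (hm : m ∈ F) (hcard : F.card = m) (j : ℕ+) :
    ∑ k ∈ F, coord k (U (e j)) ∈ ({-1, 0, 1} : Set ℝ) := by
  classical
  rw [← isClosed_neg_one_zero_one.closure_eq, Metric.mem_closure_iff]
  intro θ hθ
  obtain ⟨s, c, hs⟩ := exists_norm_sub_sum_lt (U (e j)) (θ := θ / 3) (by positivity)
  set w := ∑ k ∈ s, c k • e k with hw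
  -- `M` bounds the effect on `w` of an error `η` at each unit vector.
  set M : ℝ := ∑ k ∈ s, |c k| + 1 with hM
  have hMpos : 0 < M := by positivity
  set η : ℝ := θ / (3 * M) with hηdef
  have hηpos : 0 < η := by positivity
  have hlt : (F.card : ℝ) - η < ‖U.symm (∑ k ∈ F, e k)‖ := by
    rw [U.symm.norm_map, norm_sum_e hF]
    linarith
  obtain ⟨G, hG, hGlt⟩ := exists_lt_sum_abs_coord hlt
  -- The signs `δ` turn the absolute values in the norm into the linear functional `g = φ ∘ U.symm`,
  -- where `φ = ∑ k ∈ G, δ k • coord k`.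
  let δ : ℕ+ → ℝ := fun k => SignType.sign (coord k (U.symm (∑ k ∈ F, e k)))
  have hδ : ∀ k, δ k ∈ ({-1, 0, 1} : Set ℝ) := fun k => by
    simp only [δ]
    rcases SignType.sign (coord k (U.symm (∑ k ∈ F, e k))) with _ | _ | _ <;> simp
  have hδ1 : ∀ k, |δ k| ≤ 1 := fun k => by
    rcases hδ k with h | h | h <;> rw [h] <;> norm_num
  let g : SchreierSpace →ₗ[ℝ] ℝ :=
    ∑ k ∈ G, δ k • ((coord k : SchreierSpace →ₗ[ℝ] ℝ) ∘ₗ U.symm.toLinearEquiv.toLinearMap)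
  have hgapp : ∀ v, g v = ∑ k ∈ G, δ k * coord k (U.symm v) := fun v => by
    simp [g, LinearMap.sum_apply]
  have hg : ∀ v, |g v| ≤ ‖v‖ := fun v => by
    rw [hgapp]
    refine (Finset.abs_sum_le_sum_abs _ _).trans ?_
    rw [← U.symm.norm_map v]
    refine le_trans (Finset.sum_le_sum fun k _ => ?_) (sum_abs_coord_le_norm _ hG)
    rw [abs_mul]
    exact mul_le_of_le_one_left (abs_nonneg _) (hδ1 k)
  have hgF : F.card - η ≤ g (∑ k ∈ F, e k) := by
    rw [hgapp]
    simp only [δ, sign_mul_self]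
    exact hGlt.le
  have hclose := abs_apply_e_sub_le hm hcard hg hgF
  refine ⟨g (U (e j)), ?_, ?_⟩
  · rw [hgapp]
    simp only [U.symm_apply_apply, coord_e, mul_ite, mul_one, mul_zero, Finset.sum_ite_eq]
    split_ifs
    · exact hδ j
    · simp
  · have h1 : |∑ k ∈ F, coord k w - g w| ≤ η * ∑ k ∈ s, |c k| := by
      have h2 : ∑ k ∈ F, coord k w - g w
          = -∑ i ∈ s, c i * (g (e i) - if i ∈ F then 1 else 0) := by
        have h3 : ∑ k ∈ F, coord k w = ∑ i ∈ s, c i * (if i ∈ F then 1 else 0) := by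
          simp only [hw, map_sum, map_smul, smul_eq_mul]
          rw [Finset.sum_comm]
          refine Finset.sum_congr rfl fun i _ => ?_
          rw [← Finset.mul_sum]
          simp [coord_e]
        rw [h3, hw, map_sum]
        simp only [map_smul, smul_eq_mul, mul_sub, Finset.sum_sub_distrib]
        ring
      rw [h2, abs_neg, Finset.mul_sum]
      refine (Finset.abs_sum_le_sum_abs _ _).trans (Finset.sum_le_sum fun i _ => ?_)
      rw [abs_mul, mul_comm]
      exact mul_le_mul_of_nonneg_right (hclose i) (abs_nonneg _)
    have h4 : η * ∑ k ∈ s, |c k| ≤ θ / 3 := by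
      have h5 : η * M = θ / 3 := by rw [hηdef]; field_simp
      nlinarith
    have h6 : |∑ k ∈ F, coord k (U (e j) - w)| < θ / 3 :=
      ((Finset.abs_sum_le_sum_abs _ _).trans (sum_abs_coord_le_norm _ hF)).trans_lt hs
    have h7 : |g (U (e j) - w)| < θ / 3 := (hg _).trans_lt hs
    rw [Real.dist_eq]
    simp only [map_sub, Finset.sum_sub_distrib] at h6 h7
    rw [abs_lt] at h6 h7 ⊢
    rw [abs_le] at h1
    constructor <;> linarith [h1.1, h1.2, h6.1, h6.2, h7.1, h7.2]

/-! ### The matrix of a surjective isometry -/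

/-- `coord k (U (e j))` is the limit of the sums over the maximal sets `spread k m`, as `m` tends
to infinity. -/
theorem coord_map_e_mem (U : SchreierSpace ≃ₗᵢ[ℝ] SchreierSpace) (k j : ℕ+) :
    coord k (U (e j)) ∈ ({-1, 0, 1} : Set ℝ) := by
  have hlim : Tendsto
      (fun m => coord k (U (e j)) + ∑ i ∈ Finset.range (k - 1), coord (m + i.succPNat) (U (e j)))
      cofinite (𝓝 (coord k (U (e j)) + ∑ i ∈ Finset.range (k - 1), 0)) := by
    refine tendsto_const_nhds.add (tendsto_finsetSum _ fun i _ => ?_)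
    exact (tendsto_coord _).comp (add_left_injective i.succPNat).tendsto_cofinite
  rw [Finset.sum_const_zero, add_zero] at hlim
  refine isClosed_neg_one_zero_one.mem_of_tendsto hlim ?_
  filter_upwards [(Set.finite_Iio k).compl_mem_cofinite] with m hm
  have hkm : k ≤ m := not_lt.1 hm
  have := sum_coord_map_e_mem U (spread_mem_schreierFamily hkm) (mem_spread k m)
    (card_spread hkm) j
  rwa [spread, Finset.sum_insert (notMem_image_of_le hkm _),
    Finset.sum_image fun _ _ _ _ h => add_succPNat_injective m h] at this

theorem abs_eq_one_of_mem {x : ℝ} (hx : x ∈ ({-1, 0, 1} : Set ℝ)) (h0 : x ≠ 0) : |x| = 1 := by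
  rcases hx with rfl | rfl | rfl <;> simp at h0 ⊢

theorem eq_coord_smul_e {v : SchreierSpace} {p : ℕ+} (h : ∀ k, k ≠ p → coord k v = 0) :
    v = coord p v • e p := by
  refine ext_coord fun n => ?_
  rw [map_smul, coord_e, smul_eq_mul]
  split_ifs with hn
  · rw [hn, mul_one]
  · rw [mul_zero, h n (Ne.symm hn)]

theorem norm_e_one_add_smul_le {j : ℕ+} (hj : j ≠ 1) {t : ℝ} (ht : |t| ≤ 1) :
    ‖e 1 + t • e j‖ ≤ 1 := by
  simpa using norm_sum_e_add_le (Finset.mem_singleton_self (1 : ℕ+)) (by simp) ht (j := j)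
    (by simpa using hj)

theorem eq_zero_of_abs_add_le_one {a b : ℝ} (ha : |a| = 1) (h1 : |a + b| ≤ 1)
    (h2 : |a - b| ≤ 1) : b = 0 := by
  rw [abs_le] at h1 h2
  rcases (abs_eq zero_le_one).1 ha with rfl | rfl <;> linarith

theorem norm_map_e_one_add_le (U : SchreierSpace ≃ₗᵢ[ℝ] SchreierSpace) {j : ℕ+} (hj : j ≠ 1) :
    ‖U (e 1) + U (e j)‖ ≤ 1 := by
  rw [← map_add, U.norm_map]
  simpa using norm_e_one_add_smul_le hj (t := 1) (by simp)

theorem norm_map_e_one_sub_le (U : SchreierSpace ≃ₗᵢ[ℝ] SchreierSpace) {j : ℕ+} (hj : j ≠ 1) :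
    ‖U (e 1) - U (e j)‖ ≤ 1 := by
  rw [← map_sub, U.norm_map]
  simpa [sub_eq_add_neg] using norm_e_one_add_smul_le hj (t := -1) (by simp)

/-- If `U (e 1)` had a nonzero entry at some `k ≠ 1`, then `‖U (e 1) ± U (e j)‖ ≤ 1` would force
all `U (e j)`, `j ≠ 1`, to be multiples of `e 1`. -/
theorem coord_map_e_one (U : SchreierSpace ≃ₗᵢ[ℝ] SchreierSpace) {k : ℕ+} (hk : k ≠ 1) :
    coord k (U (e 1)) = 0 := by
  by_contra h0
  have hk1 := abs_eq_one_of_mem (coord_map_e_mem U k 1) h0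
  have hzero : ∀ j, j ≠ 1 → ∀ l, l ≠ 1 → coord l (U (e j)) = 0 := by
    intro j hj l hl
    have hp := norm_map_e_one_add_le U hj
    have hn := norm_map_e_one_sub_le U hj
    rcases eq_or_ne l k with rfl | hlk
    · refine eq_zero_of_abs_add_le_one hk1 ?_ ?_
      · simpa using (abs_coord_le_norm _ l).trans hp
      · simpa using (abs_coord_le_norm _ l).trans hn
    · have h1 := (abs_coord_add_abs_coord_le_norm _ hk hl hlk.symm).trans hp
      have h2 := (abs_coord_add_abs_coord_le_norm _ hk hl hlk.symm).trans hn
      simp only [map_add, map_sub] at h1 h2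
      -- The two bounds add up to `2 |a_k| + 2 |b_l| ≤ 2`, where `|a_k| = 1`.
      have h3 := abs_add_le (coord k (U (e 1)) + coord k (U (e j)))
        (coord k (U (e 1)) - coord k (U (e j)))
      have h4 := abs_sub (coord l (U (e 1)) + coord l (U (e j)))
        (coord l (U (e 1)) - coord l (U (e j)))
      rw [show coord k (U (e 1)) + coord k (U (e j)) + (coord k (U (e 1)) - coord k (U (e j)))
        = 2 * coord k (U (e 1)) by ring, abs_mul, hk1, abs_two] at h3
      rw [show coord l (U (e 1)) + coord l (U (e j)) - (coord l (U (e 1)) - coord l (U (e j)))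
        = 2 * coord l (U (e j)) by ring, abs_mul, abs_two] at h4
      exact abs_nonpos_iff.1 (by linarith)
  have h2 := eq_coord_smul_e (hzero 2 (by decide))
  have h3 := eq_coord_smul_e (hzero 3 (by decide))
  set c := coord 1 (U (e 2))
  set d := coord 1 (U (e 3))
  have hdep : d • e 2 = c • e 3 := U.injective (by
    rw [map_smul, map_smul, h2, h3, smul_smul, smul_smul, mul_comm])
  have hc : c = 0 := by
    have := congrArg (coord 3) hdep
    simpa [coord_e, show (2 : ℕ+) ≠ 3 by decide] using this.symm
  have hnorm : ‖U (e 2)‖ = 1 := by rw [U.norm_map, norm_e]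
  rw [h2, hc, zero_smul, norm_zero] at hnorm
  exact zero_ne_one hnorm

theorem exists_map_e_eq (U : SchreierSpace ≃ₗᵢ[ℝ] SchreierSpace) (j : ℕ+) :
    ∃ (p : ℕ+) (s : ℝ), |s| = 1 ∧ U (e j) = s • e p := by
  have hnorm : ∀ i, ‖U (e i)‖ = 1 := fun i => by rw [U.norm_map, norm_e]
  suffices h : ∃ p, ∀ k, k ≠ p → coord k (U (e j)) = 0 by
    obtain ⟨p, hp⟩ := h
    have heq := eq_coord_smul_e hp
    refine ⟨p, coord p (U (e j)), ?_, heq⟩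
    have := hnorm j
    rwa [heq, norm_smul, norm_e, mul_one, Real.norm_eq_abs] at this
  rcases eq_or_ne j 1 with rfl | hj
  · exact ⟨1, fun k hk => coord_map_e_one U hk⟩
  have hone : coord 1 (U (e j)) = 0 := by
    have h1 : |coord 1 (U (e 1))| = 1 := by
      have h := hnorm 1
      rwa [eq_coord_smul_e (fun k hk => coord_map_e_one U hk), norm_smul, norm_e, mul_one,
        Real.norm_eq_abs] at h
    refine eq_zero_of_abs_add_le_one h1 ?_ ?_
    · simpa using (abs_coord_le_norm _ 1).trans (norm_map_e_one_add_le U hj)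
    · simpa using (abs_coord_le_norm _ 1).trans (norm_map_e_one_sub_le U hj)
  by_cases hall : ∀ k, coord k (U (e j)) = 0
  · exact ⟨1, fun k _ => hall k⟩
  obtain ⟨p, hp⟩ := not_forall.1 hall
  have hp1 : p ≠ 1 := by
    rintro rfl
    exact hp hone
  refine ⟨p, fun k hk => ?_⟩
  rcases eq_or_ne k 1 with rfl | hk1
  · exact hone
  have h := abs_coord_add_abs_coord_le_norm (U (e j)) hp1 hk1 hk.symm
  rw [hnorm, abs_eq_one_of_mem (coord_map_e_mem U p j) hp] at h
  exact abs_nonpos_iff.1 (by linarith)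

/-- The image of `∑ k ∈ F, e k` has norm `card F` only if `π` maps `F` into a Schreier set;
applied to `F` with minimum `n` and cardinality `n`, this bounds `π n` from below. -/
theorem le_of_map_e_eq (U : SchreierSpace ≃ₗᵢ[ℝ] SchreierSpace) {π : ℕ+ → ℕ+} {s : ℕ+ → ℝ}
    (hπ : Function.Injective π) (hs : ∀ j, |s j| = 1) (h : ∀ j, U (e j) = s j • e (π j)) (n : ℕ+) :
    n ≤ π n := by
  classical
  set F := spread n n
  have hcard : F.card = n := card_spread le_rfl
  have hlt : (F.card : ℝ) - 1 < ‖U (∑ k ∈ F, e k)‖ := by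
    rw [U.norm_map, norm_sum_e (spread_mem_schreierFamily le_rfl)]
    linarith
  obtain ⟨H, hH, hlt⟩ := exists_lt_sum_abs_coord hlt
  have hle : ∑ k ∈ H, |coord k (U (∑ k ∈ F, e k))| ≤ (F.filter fun l => π l ∈ H).card := by
    calc ∑ k ∈ H, |coord k (U (∑ k ∈ F, e k))|
        ≤ ∑ k ∈ H, ∑ l ∈ F, (if π l = k then (1 : ℝ) else 0) := by
          refine Finset.sum_le_sum fun k _ => ?_
          rw [map_sum, map_sum]
          refine (Finset.abs_sum_le_sum_abs _ _).trans (Finset.sum_le_sum fun l _ => ?_)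
          rw [h, map_smul, coord_e, smul_eq_mul, abs_mul, hs, one_mul]
          split_ifs <;> simp
      _ = (F.filter fun l => π l ∈ H).card := by
          rw [Finset.sum_comm]
          simp
  have hlt' : F.card < (F.filter fun l => π l ∈ H).card + 1 := by
    have : (F.card : ℝ) < (F.filter fun l => π l ∈ H).card + 1 := by linarith
    exact_mod_cast this
  have hall : ∀ l ∈ F, π l ∈ H := by
    refine Finset.filter_eq_self.1 (Finset.eq_of_subset_of_card_le (Finset.filter_subset _ _) ?_)
    omega
  have hFH : F.card ≤ H.card := Finset.card_le_card_of_injOn π hall hπ.injOn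
  rw [← PNat.coe_le_coe, ← hcard]
  exact hFH.trans (mem_schreierFamily_iff.1 hH _ (hall n (mem_spread n n)))

theorem exists_sign_map_e (U : SchreierSpace ≃ₗᵢ[ℝ] SchreierSpace) :
    ∃ ε : ℕ+ → ℤˣ, ∀ i, U (e i) = ((ε i : ℤ) : ℝ) • e i := by
  choose π s hs hπ using exists_map_e_eq U
  choose σ t ht hσ using exists_map_e_eq U.symm
  -- The index maps of an isometry and of its inverse are inverse to each other.
  have inverse : ∀ (V : SchreierSpace ≃ₗᵢ[ℝ] SchreierSpace) {π σ : ℕ+ → ℕ+} {s t : ℕ+ → ℝ},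
      (∀ j, V (e j) = s j • e (π j)) → (∀ j, V.symm (e j) = t j • e (σ j)) →
        Function.LeftInverse σ π := by
    intro V π σ s t h1 h2 n
    have h3 : e n = (s n * t (π n)) • e (σ (π n)) := by
      rw [mul_smul, ← h2, ← map_smul, ← h1, V.symm_apply_apply]
    by_contra hne
    have := congrArg (coord n) h3
    rw [map_smul, coord_e_self, coord_e, if_neg hne, smul_zero] at this
    exact one_ne_zero this
  have hσπ := inverse U hπ hσ
  have hπσ := inverse U.symm hσ (by simpa using hπ)
  have hid : ∀ n, π n = n := fun n => by
    refine le_antisymm ?_ (le_of_map_e_eq U hσπ.injective hs hπ n)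
    have := le_of_map_e_eq U.symm hπσ.injective ht hσ (π n)
    rwa [hσπ n] at this
  have hsign : ∀ i, ∃ u : ℤˣ, ((u : ℤ) : ℝ) = s i := fun i => by
    rcases (abs_eq zero_le_one).1 (hs i) with h | h
    · exact ⟨1, by simp [h]⟩
    · exact ⟨-1, by simp [h]⟩
  choose ε hε using hsign
  exact ⟨ε, fun i => by rw [hπ, hid, hε]⟩

/-! ### Diagonal isometries -/

theorem sign_mul_sign (u : ℤˣ) : ((u : ℤ) : ℝ) * ((u : ℤ) : ℝ) = 1 := by
  rcases Int.units_eq_one_or u with rfl | rfl <;> simp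

theorem abs_sign (u : ℤˣ) : |((u : ℤ) : ℝ)| = 1 := by
  rcases Int.units_eq_one_or u with rfl | rfl <;> simp

/-- Coordinatewise multiplication by signs on `c₀₀`. -/
noncomputable def signMulC00 (ε : ℕ+ → ℤˣ) : C00 →ₗ[ℝ] C00 where
  toFun x := Finsupp.onFinset (show ℕ+ →₀ ℝ from x).support (fun n => ((ε n : ℤ) : ℝ) * x n)
    fun _ hn => Finsupp.mem_support_iff.2 (right_ne_zero_of_mul hn)
  map_add' x y := C00.ext fun n =>
    (congrArg (((ε n : ℤ) : ℝ) * ·) (C00.add_apply x y n)).trans (mul_add _ (x n) (y n))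
  map_smul' c x := C00.ext fun n =>
    (congrArg (((ε n : ℤ) : ℝ) * ·) (C00.smul_apply c x n)).trans (mul_left_comm _ c (x n))

theorem signMulC00_apply (ε : ℕ+ → ℤˣ) (x : C00) (n : ℕ+) :
    signMulC00 ε x n = ((ε n : ℤ) : ℝ) * x n := rfl

theorem norm_signMulC00 (ε : ℕ+ → ℤˣ) (x : C00) : ‖signMulC00 ε x‖ = ‖x‖ := by
  simp only [C00.norm_def, signMulC00_apply, abs_mul, abs_sign, one_mul]

/-- Coordinatewise multiplication by signs on Schreier's space, as a continuous linear map: the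
extension of `signMulC00` to the completion. -/
noncomputable def signMul (ε : ℕ+ → ℤˣ) : SchreierSpace →L[ℝ] SchreierSpace :=
  ((UniformSpace.Completion.toComplL : C00 →L[ℝ] SchreierSpace) ∘L
    (⟨signMulC00 ε, norm_signMulC00 ε⟩ : C00 →ₗᵢ[ℝ] C00).toContinuousLinearMap).extend
      (UniformSpace.Completion.toComplL : C00 →L[ℝ] SchreierSpace)

theorem coord_signMul (ε : ℕ+ → ℤˣ) (v : SchreierSpace) (n : ℕ+) :
    coord n (signMul ε v) = ((ε n : ℤ) : ℝ) * coord n v := by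
  induction v using UniformSpace.Completion.induction_on with
  | hp => exact isClosed_eq (by fun_prop) (by fun_prop)
  | ih x =>
    have h : signMul ε (x : SchreierSpace) = (signMulC00 ε x : C00) :=
      ContinuousLinearMap.extend_eq _
        (e := (UniformSpace.Completion.toComplL : C00 →L[ℝ] SchreierSpace))
        UniformSpace.Completion.denseRange_coe (UniformSpace.Completion.isUniformInducing_coe C00) x
    rw [h, coord_coe, coord_coe, signMulC00_apply]

theorem signMul_e (ε : ℕ+ → ℤˣ) (i : ℕ+) : signMul ε (e i) = ((ε i : ℤ) : ℝ) • e i := by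
  refine ext_coord fun n => ?_
  rw [coord_signMul, map_smul, coord_e, smul_eq_mul]
  split_ifs with h
  · rw [h]
  · rw [mul_zero, mul_zero]

theorem involutive_of_coord_eq {ε : ℕ+ → ℤˣ} {T : SchreierSpace → SchreierSpace}
    (hT : ∀ x n, coord n (T x) = ((ε n : ℤ) : ℝ) * coord n x) : Function.Involutive T :=
  fun x => ext_coord fun n => by rw [hT, hT, ← mul_assoc, sign_mul_sign, one_mul]

theorem norm_eq_of_coord_eq {ε : ℕ+ → ℤˣ} {T : SchreierSpace → SchreierSpace}
    (hT : ∀ x n, coord n (T x) = ((ε n : ℤ) : ℝ) * coord n x) (x : SchreierSpace) :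
    ‖T x‖ = ‖x‖ :=
  norm_eq_of_abs_coord_eq fun n => by rw [hT, abs_mul, abs_sign, one_mul]

/-- Coordinatewise multiplication by signs, as a homomorphism into the group of surjective linear
isometries. -/
noncomputable def signIsometry : (ℕ+ → ℤˣ) →* (SchreierSpace ≃ₗᵢ[ℝ] SchreierSpace) where
  toFun ε :=
    { LinearEquiv.ofInvolutive (signMul ε : SchreierSpace →ₗ[ℝ] SchreierSpace)
        (involutive_of_coord_eq (coord_signMul ε)) with
      norm_map' := norm_eq_of_coord_eq (coord_signMul ε) }
  map_one' := LinearIsometryEquiv.ext fun v => ext_coord fun n => by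
    refine (coord_signMul 1 v n).trans ?_
    simp
  map_mul' ε δ := LinearIsometryEquiv.ext fun v => ext_coord fun n => by
    refine (coord_signMul (ε * δ) v n).trans (Eq.symm ?_)
    refine (coord_signMul ε (signMul δ v) n).trans ?_
    rw [coord_signMul, Pi.mul_apply, Units.val_mul, Int.cast_mul, mul_assoc]

theorem signIsometry_apply (ε : ℕ+ → ℤˣ) (v : SchreierSpace) :
    signIsometry ε v = signMul ε v := rfl

theorem exists_eq_signMul (U : SchreierSpace ≃ₗᵢ[ℝ] SchreierSpace) :
    ∃ ε : ℕ+ → ℤˣ, ∀ v, U v = signMul ε v := by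
  obtain ⟨ε, hε⟩ := exists_sign_map_e U
  have h : (U.toContinuousLinearEquiv : SchreierSpace →L[ℝ] SchreierSpace) = signMul ε :=
    clm_ext_e fun i => (hε i).trans (signMul_e ε i).symm
  exact ⟨ε, fun v => congrArg (fun A : SchreierSpace →L[ℝ] SchreierSpace => A v) h⟩

theorem signIsometry_bijective : Function.Bijective signIsometry := by
  constructor
  · intro ε δ h
    funext n
    have h1 := congrArg (fun A => coord n (A (e n))) h
    simp only [signIsometry_apply, coord_signMul, coord_e_self, mul_one] at h1
    exact Units.ext (by exact_mod_cast h1)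
  · intro U
    obtain ⟨ε, hε⟩ := exists_eq_signMul U
    exact ⟨ε, LinearIsometryEquiv.ext fun v => (hε v).symm⟩

end SchreierSpace

/-- Schreier's space has a diagonal standard group of isometries: the surjective linear isometries
are exactly the maps `(aₙ) ↦ (εₙ aₙ)` with signs `εₙ`, and `ε ↦ (eᵢ ↦ εᵢ eᵢ)` is a group
isomorphism of `{±1}^ℕ` onto the group of surjective linear isometries. -/
theorem mainTheorem2 :
    (∀ T : SchreierSpace →ₗ[ℝ] SchreierSpace,
      ((∀ x, ‖T x‖ = ‖x‖) ∧ Function.Surjective T) ↔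
        ∃ ε : ℕ+ → ℤˣ, ∀ (x : SchreierSpace) (n : ℕ+),
          SchreierSpace.coord n (T x) = ((ε n : ℤ) : ℝ) * SchreierSpace.coord n x) ∧
    ∃ Φ : (ℕ+ → ℤˣ) ≃* (SchreierSpace ≃ₗᵢ[ℝ] SchreierSpace),
      ∀ (ε : ℕ+ → ℤˣ) (i : ℕ+),
        Φ ε (SchreierSpace.e i) = ((ε i : ℤ) : ℝ) • SchreierSpace.e i := by
  refine ⟨fun T => ⟨fun ⟨hT, hsurj⟩ => ?_, fun ⟨ε, hε⟩ => ?_⟩, ?_⟩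
  · obtain ⟨ε, hε⟩ := SchreierSpace.exists_eq_signMul
      (LinearIsometryEquiv.ofSurjective ⟨T, hT⟩ hsurj)
    exact ⟨ε, fun x n =>
      (congrArg (SchreierSpace.coord n) (hε x)).trans (SchreierSpace.coord_signMul ε x n)⟩
  · exact ⟨SchreierSpace.norm_eq_of_coord_eq hε,
      (SchreierSpace.involutive_of_coord_eq hε).surjective⟩
  · exact ⟨MulEquiv.ofBijective SchreierSpace.signIsometry SchreierSpace.signIsometry_bijective,
      SchreierSpace.signMul_e⟩
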